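/- Let $V$ be a finite nonempty set, $d\in\mathbb N$, and $\mathcal H_V=\bigotimes_{v\in V}\mathbb C^d$. A state is a positive semidefinite operator of trace $1$ on $\mathcal H_V$; an observable is a self-adjoint operator on $\mathcal H_V$. For a state $\rho$, a self-adjoint $A$ and $r\in\mathbb R$, put $\mathbb P_\rho(A\ge r)=\operatorname{tr}[\rho\{A\ge r\}]$, where $\{A\ge r\}$ is the projector onto the span of the eigenvectors of $A$ with eigenvalue at least $r$, and $\langle O\rangle_\sigma=\operatorname{tr}[\sigma O]$. For self-adjoint $H$ let $$\|H\|_L=2\max_{v\in V}\min_{H_{v^c}}\|H-H_{v^c}\otimes\mathbb I_v\|_\infty,$$ the minimum being over self-adjoint operators $H_{v^c}$ on $\bigotimes_{w\ne v}\mathbb C^d$, and for arbitrary $Z$ let $\|Z\|_L=\max\{\|\operatorname{Re}Z\|_L,\|\operatorname{Im}Z\|_L\}$, where $\operatorname{Re}Z=\frac12(Z+Z^\dagger)$ and $\operatorname{Im}Z=\frac1{2i}(Z-Z^\dagger)$. For $\alpha>1$ let $$D_\alpha(\rho\|\sigma)=\frac1{\alpha-1}\log\operatorname{tr}\Big[\big(\sigma^{\frac{1-\alpha}{2\alpha}}\rho\,\sigma^{\frac{1-\alpha}{2\alpha}}\big)^\alpha\Big]$$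 if the support of $\rho$ is contained in that of $\sigma$, and $D_\alpha(\rho\|\sigma)=+\infty$ otherwise. Conventions: $\log 0=-\infty$, $e^{-\infty}=0$, and $t/0=+\infty$ for $t>0$. Let $\sigma>0$ be a full-rank state on $\mathcal H_V$. (1) For every state $\rho$, every operator $0\le E\le\mathbb I$ and every $\alpha>1$, $$\operatorname{tr}[E\rho]\le\exp\Big(\frac{\alpha-1}{\alpha}\big(D_\alpha(\rho\|\sigma)+\log\operatorname{tr}[E\sigma]\big)\Big).$$ (2) Let $c,K>0$, let $O$ be an observable and $a>0$, and suppose that $$\mathbb P_\sigma\big(|O-\langle O\rangle_\sigma\mathbb I|\ge a|V|\big)\le K\exp\Big(-\frac{c\,a^2|V|}{\|\sigma^{-1/2}O\sigma^{1/2}\|_L^2}\Big).\qquad(\ast)$$ Then for every state $\rho$ and every $\alpha>1$, $$\mathbb P_\rho\big(|O-\langle O\rangle_\sigma\mathbb I|\ge a|V|\big)\le\exp\Big(\frac{\alpha-1}{\alpha}\Big(D_\alpha(\rho\|\sigma)-\frac{c\,a^2|V|}{\|\sigma^{-1/2}O\sigma^{1/2}\|_L^2}+\log K\Big)\Big).\qquad(\ast\ast)$$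 (3) In particular, if $\sigma$ satisfies Gaussian concentration with constants $c,K>0$, i.e. $(\ast)$ holds for all observables $O$ and all $a>0$, then $(\ast\ast)$ holds for all states $\rho$, all observables $O$, all $a>0$ and all $\alpha>1$. -/

import Mathlib

open scoped ComplexOrder

namespace QuditConcentration

noncomputable section

/-- Linear operators on the `|V|`-qudit space `⨂_{v ∈ V} ℂ^d`, written as matrices in the
computational basis, which is indexed by the configurations `V → Fin d`. -/
abbrev Op (V : Type*) (d : ℕ) : Type _ := Matrix (V → Fin d) (V → Fin d) ℂ

/-- A quantum state: a positive semidefinite operator of trace one. -/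
def IsState {V : Type*} [Fintype V] [DecidableEq V] {d : ℕ} (ρ : Op V d) : Prop :=
  ρ.PosSemidef ∧ ρ.trace = 1

/-- A POVM element: an operator `E` with `0 ≤ E ≤ 𝕀`. -/
def IsPOVMElement {V : Type*} [Fintype V] [DecidableEq V] {d : ℕ} (E : Op V d) : Prop :=
  E.PosSemidef ∧ (1 - E).PosSemidef

/-- The value `tr[σ O]`; it is real when `σ` and `O` are self-adjoint. -/
def expect {V : Type*} [Fintype V] [DecidableEq V] {d : ℕ} (σ O : Op V d) : ℝ :=
  ((σ * O).trace).re

/-- The power `A ^ p` of a positive semidefinite operator (functional calculus). -/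
def opPow {V : Type*} [Fintype V] [DecidableEq V] {d : ℕ} (A : Op V d) (p : ℝ) : Op V d :=
  cfc (fun x : ℝ => x ^ p) A

/-- The absolute value `|A|` of a self-adjoint operator (functional calculus). -/
def opAbs {V : Type*} [Fintype V] [DecidableEq V] {d : ℕ} (A : Op V d) : Op V d :=
  cfc (fun x : ℝ => |x|) A

open Classical in
/-- The projector `{A ≥ r}` onto the span of the eigenvectors of the self-adjoint operator `A`
whose eigenvalue is at least `r`. -/
def projGE {V : Type*} [Fintype V] [DecidableEq V] {d : ℕ} (A : Op V d) (r : ℝ) : Op V d :=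
  cfc (fun x : ℝ => if r ≤ x then (1 : ℝ) else 0) A

/-- `ℙ_σ(A ≥ r) = tr[σ {A ≥ r}]`. -/
def prob {V : Type*} [Fintype V] [DecidableEq V] {d : ℕ} (σ A : Op V d) (r : ℝ) : ℝ :=
  expect σ (projGE A r)

/-- `ℙ_ρ(|O - ⟨O⟩_σ 𝕀| ≥ r)`. -/
def deviationProb {V : Type*} [Fintype V] [DecidableEq V] {d : ℕ}
    (ρ σ O : Op V d) (r : ℝ) : ℝ :=
  prob ρ (opAbs (O - ((expect σ O : ℝ) : ℂ) • (1 : Op V d))) r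

/-- The operator norm for the Euclidean norm of the qudit space. -/
def opNorm {V : Type*} [Fintype V] [DecidableEq V] {d : ℕ} (A : Op V d) : ℝ :=
  ‖Matrix.toEuclideanCLM (𝕜 := ℂ) A‖

/-- `B ⊗ 𝕀_v`, for an operator `B` on the qudits other than `v`. -/
def tensorId {V : Type*} {d : ℕ} (v : V) (B : Op {w : V // w ≠ v} d) : Op V d :=
  fun x y => if x v = y v then B (fun w => x w) (fun w => y w) else 0

/-- The Lipschitz constant of a self-adjoint operator,
`2 max_v min_B ‖H - B ⊗ 𝕀_v‖`, over self-adjoint `B` on the qudits other than `v`. -/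
def lipSA {V : Type*} [Fintype V] [DecidableEq V] {d : ℕ} (H : Op V d) : ℝ :=
  2 * ⨆ v : V, ⨅ B : {B : Op {w : V // w ≠ v} d // B.IsHermitian},
    opNorm (H - tensorId v B.1)

/-- The Lipschitz constant of an arbitrary operator: the larger of those of its real part
`(Z + Zᴴ) / 2` and its imaginary part `(Z - Zᴴ) / (2 i)`. -/
def lip {V : Type*} [Fintype V] [DecidableEq V] {d : ℕ} (Z : Op V d) : ℝ :=
  max (lipSA (realPart Z : Op V d)) (lipSA (imaginaryPart Z : Op V d))

open Classical in
/-- The sandwiched Rényi divergence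
`D_α(ρ‖σ) = (α - 1)⁻¹ log tr[(σ^((1-α)/(2α)) ρ σ^((1-α)/(2α)))^α]`,
equal to `+∞` if the support (i.e. the range) of `ρ` is not contained in that of `σ`. -/
def renyiDiv {V : Type*} [Fintype V] [DecidableEq V] {d : ℕ} (α : ℝ) (ρ σ : Op V d) : EReal :=
  if LinearMap.range ρ.mulVecLin ≤ LinearMap.range σ.mulVecLin then
    ((1 / (α - 1) * Real.log
      ((opPow (opPow σ ((1 - α) / (2 * α)) * ρ * opPow σ ((1 - α) / (2 * α))) α).trace).re :
        ℝ) : EReal)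
  else ⊤

/-- The Gaussian rate `c a² |V| / ‖σ^(-1/2) O σ^(1/2)‖_L²`. It is computed in `[0, ∞]`, so it is
`∞` if the Lipschitz constant vanishes (and `c, a > 0`). -/
def gaussRate {V : Type*} [Fintype V] [DecidableEq V] {d : ℕ}
    (σ O : Op V d) (c a : ℝ) : ENNReal :=
  ENNReal.ofReal (c * a ^ 2 * Fintype.card V) /
    ENNReal.ofReal (lip (opPow σ (-(1 / 2)) * O * opPow σ (1 / 2))) ^ 2

/-- The Gaussian tail bound in the state `σ` for one observable `O` and one `a`:
`ℙ_σ(|O - ⟨O⟩_σ 𝕀| ≥ a |V|) ≤ K exp(-c a² |V| / ‖σ^(-1/2) O σ^(1/2)‖_L²)`. -/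
def GaussianTail {V : Type*} [Fintype V] [DecidableEq V] {d : ℕ}
    (σ O : Op V d) (c K a : ℝ) : Prop :=
  ((deviationProb σ σ O (a * Fintype.card V) : ℝ) : EReal) ≤
    (K : EReal) * (EReal.exp (-(gaussRate σ O c a : EReal)) : EReal)

/-- `σ` satisfies Gaussian concentration with constants `c`, `K`: the Gaussian tail bound holds
for all observables and all `a > 0`. -/
def GaussianConcentration {V : Type*} [Fintype V] [DecidableEq V] {d : ℕ}
    (σ : Op V d) (c K : ℝ) : Prop :=
  ∀ O : Op V d, O.IsHermitian → ∀ a : ℝ, 0 < a → GaussianTail σ O c K a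

/-- The transferred tail bound:
`ℙ_ρ(|O - ⟨O⟩_σ 𝕀| ≥ a |V|) ≤
  exp(((α-1)/α) (D_α(ρ‖σ) - c a² |V| / ‖σ^(-1/2) O σ^(1/2)‖_L² + log K))`. -/
def TransferredTail {V : Type*} [Fintype V] [DecidableEq V] {d : ℕ}
    (ρ σ O : Op V d) (c K a α : ℝ) : Prop :=
  ((deviationProb ρ σ O (a * Fintype.card V) : ℝ) : EReal) ≤
    (EReal.exp ((((α - 1) / α : ℝ) : EReal) *
      (renyiDiv α ρ σ - (gaussRate σ O c a : EReal) + ((Real.log K : ℝ) : EReal))) : EReal)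

end

end QuditConcentration

/-! Write `s = (α-1)/(2α)` and `β = α/(α-1)`, the exponent conjugate to `α`. Since `σ` is
invertible, `tr[ρE] = tr[(σ^(-s) ρ σ^(-s)) (σ^s E σ^s)]`, and Hölder bounds this by the Rényi trace
to the power `1/α` times `tr[(σ^s E σ^s)^β]^(1/β)`. The last trace equals `tr[(√E σ^(2s) √E)^β]`,
and Jensen for the contraction `√E` bounds it by `tr[√E σ^(2sβ) √E] = tr[σE]`, because `2sβ = 1`.
This is `re_trace_mul_le_sandwiched`. Taking logarithms gives the measurement bound; the spectral
projector as `E` gives the tail bounds. -/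

namespace QuditConcentration

/-! ### Trace inequalities for complex matrices. -/

section Matrix

open Matrix

variable {n : Type*} [Fintype n] [DecidableEq n]

theorem cfc_isHermitian (f : ℝ → ℝ) (A : Matrix n n ℂ) : (cfc f A).IsHermitian :=
  cfc_predicate f A

/-- The spectrum is finite, so the functional calculus also admits step functions and negative
powers. -/
theorem continuousOn_spectrum (f : ℝ → ℝ) (A : Matrix n n ℂ) :
    ContinuousOn f (spectrum ℝ A) :=
  A.finite_real_spectrum.continuousOn f

theorem cfc_eq_conj_diagonal {A : Matrix n n ℂ} (hA : A.IsHermitian) (f : ℝ → ℝ) :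
    cfc f A = (hA.eigenvectorUnitary : Matrix n n ℂ) *
      diagonal (fun i => (f (hA.eigenvalues i) : ℂ)) *
        (hA.eigenvectorUnitary : Matrix n n ℂ)ᴴ := by
  rw [hA.cfc_eq, IsHermitian.cfc, Unitary.conjStarAlgAut_apply]
  rfl

theorem conjTranspose_eigenvectorUnitary_mul {A : Matrix n n ℂ} (hA : A.IsHermitian) :
    (hA.eigenvectorUnitary : Matrix n n ℂ)ᴴ * (hA.eigenvectorUnitary : Matrix n n ℂ) = 1 :=
  Unitary.coe_star_mul_self hA.eigenvectorUnitary

theorem eigenvectorUnitary_mul_conjTranspose {A : Matrix n n ℂ} (hA : A.IsHermitian) :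
    (hA.eigenvectorUnitary : Matrix n n ℂ) * (hA.eigenvectorUnitary : Matrix n n ℂ)ᴴ = 1 :=
  Unitary.coe_mul_star_self hA.eigenvectorUnitary

theorem eigenvalues_eq_conj_apply {A : Matrix n n ℂ} (hA : A.IsHermitian) (i : n) :
    ((hA.eigenvectorUnitary : Matrix n n ℂ)ᴴ * A * (hA.eigenvectorUnitary : Matrix n n ℂ)) i i =
      hA.eigenvalues i := by
  have h := cfc_eq_conj_diagonal hA id
  rw [cfc_id ℝ A hA.isSelfAdjoint] at h
  set U := (hA.eigenvectorUnitary : Matrix n n ℂ)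
  have hU : Uᴴ * U = 1 := conjTranspose_eigenvectorUnitary_mul hA
  have : Uᴴ * A * U = diagonal (fun i => (hA.eigenvalues i : ℂ)) := by
    conv_lhs => rw [h]
    calc _ = (Uᴴ * U) * diagonal (fun i => (hA.eigenvalues i : ℂ)) * (Uᴴ * U) := by
          simp only [Matrix.mul_assoc, id]
      _ = _ := by rw [hU, one_mul, mul_one]
  rw [this, diagonal_apply_eq]

/-- The weights, the spectral measure of column `i` of `M`, do not depend on `f`: matrix
inequalities reduce to scalar ones. -/
theorem re_conj_cfc_apply {A : Matrix n n ℂ} (hA : A.IsHermitian) (f : ℝ → ℝ)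
    (M : Matrix n n ℂ) (i : n) :
    ((Mᴴ * cfc f A * M) i i).re =
      ∑ j, ‖((hA.eigenvectorUnitary : Matrix n n ℂ)ᴴ * M) j i‖ ^ 2 * f (hA.eigenvalues j) := by
  rw [cfc_eq_conj_diagonal hA f]
  set U := (hA.eigenvectorUnitary : Matrix n n ℂ)
  have : Mᴴ * (U * diagonal (fun i => (f (hA.eigenvalues i) : ℂ)) * Uᴴ) * M =
      (Uᴴ * M)ᴴ * (diagonal (fun i => (f (hA.eigenvalues i) : ℂ)) * (Uᴴ * M)) := by
    simp only [conjTranspose_mul, conjTranspose_conjTranspose, Matrix.mul_assoc]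
  rw [this, Matrix.mul_apply, Complex.re_sum]
  refine Finset.sum_congr rfl fun j _ => ?_
  rw [diagonal_mul, conjTranspose_apply, mul_left_comm, RCLike.star_def,
    ← Complex.normSq_eq_conj_mul_self, ← Complex.ofReal_mul,
    Complex.ofReal_re, Complex.normSq_eq_norm_sq, mul_comm]

theorem trace_cfc_eq_sum {A : Matrix n n ℂ} (hA : A.IsHermitian) (f : ℝ → ℝ) :
    (cfc f A).trace = ∑ i, ((f (hA.eigenvalues i) : ℝ) : ℂ) := by
  rw [cfc_eq_conj_diagonal hA f, Matrix.trace_mul_comm, ← Matrix.mul_assoc,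
    conjTranspose_eigenvectorUnitary_mul, one_mul, trace_diagonal]

/-- Scalar Jensen for the spectral weights. Total mass below one is harmless, as `x ^ p` vanishes at
zero. -/
theorem re_conj_apply_rpow_le {A : Matrix n n ℂ} (hA : A.PosSemidef) {p : ℝ} (hp : 1 ≤ p)
    (M : Matrix n n ℂ) (i : n) (hM : ((Mᴴ * M) i i).re ≤ 1) :
    ((Mᴴ * A * M) i i).re ^ p ≤ ((Mᴴ * cfc (fun x : ℝ => x ^ p) A * M) i i).re := by
  have h1 := re_conj_cfc_apply hA.1 id M i
  have h2 := re_conj_cfc_apply hA.1 (fun _ => 1) M i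
  rw [cfc_id ℝ A hA.1.isSelfAdjoint] at h1
  rw [cfc_const_one ℝ A hA.1.isSelfAdjoint, mul_one] at h2
  rw [h1, re_conj_cfc_apply hA.1]
  simp only [mul_one, id] at h2 ⊢
  rw [h2] at hM
  set w : n → ℝ := fun j => ‖((hA.1.eigenvectorUnitary : Matrix n n ℂ)ᴴ * M) j i‖ ^ 2
  have hw : ∀ j, 0 ≤ w j := fun j => sq_nonneg _
  have hl := hA.eigenvalues_nonneg
  have hp0 : 0 < p := by linarith
  have hS : 0 ≤ ∑ j, w j * hA.1.eigenvalues j ^ p :=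
    Finset.sum_nonneg fun j _ => mul_nonneg (hw j) (Real.rpow_nonneg (hl j) _)
  have key := Real.inner_le_weight_mul_Lp_of_nonneg Finset.univ hp w hA.1.eigenvalues hw hl
  have h3 : (∑ j, w j) ^ (1 - p⁻¹) ≤ 1 :=
    Real.rpow_le_one (Finset.sum_nonneg fun j _ => hw j) hM
      (sub_nonneg.2 (inv_le_one_of_one_le₀ hp))
  have h4 : ∑ j, w j * hA.1.eigenvalues j ≤ (∑ j, w j * hA.1.eigenvalues j ^ p) ^ p⁻¹ :=
    key.trans (mul_le_of_le_one_left (Real.rpow_nonneg hS _) h3)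
  calc (∑ j, w j * hA.1.eigenvalues j) ^ p
      ≤ ((∑ j, w j * hA.1.eigenvalues j ^ p) ^ p⁻¹) ^ p :=
        Real.rpow_le_rpow (Finset.sum_nonneg fun j _ => mul_nonneg (hw j) (hl j)) h4 hp0.le
    _ = _ := Real.rpow_inv_rpow hS hp0.ne'

/-- The trace form of Jensen's inequality for a contraction `K` and the function `x ^ p`. -/
theorem re_trace_conj_rpow_le {X : Matrix n n ℂ} (hX : X.PosSemidef) {p : ℝ} (hp : 1 ≤ p)
    (K : Matrix n n ℂ) (hK : (1 - Kᴴ * K).PosSemidef) :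
    (cfc (fun x : ℝ => x ^ p) (Kᴴ * X * K)).trace.re ≤
      (Kᴴ * cfc (fun x : ℝ => x ^ p) X * K).trace.re := by
  have hY : (Kᴴ * X * K).PosSemidef := hX.conjTranspose_mul_mul_same K
  have hev := eigenvalues_eq_conj_apply hY.1
  have hW' : _ * _ = (1 : Matrix n n ℂ) := eigenvectorUnitary_mul_conjTranspose hY.1
  have hW : _ * _ = (1 : Matrix n n ℂ) := conjTranspose_eigenvectorUnitary_mul hY.1
  rw [trace_cfc_eq_sum hY.1]
  set W := (hY.1.eigenvectorUnitary : Matrix n n ℂ)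
  -- In an eigenbasis `W` of `Kᴴ * X * K` the left trace is a sum of powers of diagonal entries, so
  -- the claim can be checked entrywise.
  have htr : (Kᴴ * cfc (fun x : ℝ => x ^ p) X * K).trace =
      ((K * W)ᴴ * cfc (fun x : ℝ => x ^ p) X * (K * W)).trace := by
    have : (K * W)ᴴ * cfc (fun x : ℝ => x ^ p) X * (K * W) =
        Wᴴ * ((Kᴴ * cfc (fun x : ℝ => x ^ p) X * K) * W) := by
      simp only [conjTranspose_mul, Matrix.mul_assoc]
    rw [this, Matrix.trace_mul_comm Wᴴ, Matrix.mul_assoc _ W, hW', mul_one]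
  rw [htr, Matrix.trace, Complex.re_sum, Complex.re_sum]
  refine Finset.sum_le_sum fun i _ => ?_
  have hcon : (((K * W)ᴴ * (K * W)) i i).re ≤ 1 := by
    have h := (hK.conjTranspose_mul_mul_same W).diag_nonneg (i := i)
    have e : Wᴴ * (1 - Kᴴ * K) * W = 1 - (K * W)ᴴ * (K * W) := by
      rw [Matrix.mul_sub, Matrix.sub_mul, mul_one, hW, conjTranspose_mul]
      simp only [Matrix.mul_assoc]
    rw [e, Matrix.sub_apply, one_apply_eq] at h
    have := (Complex.le_def.1 h).1
    simp only [Complex.zero_re, Complex.sub_re, Complex.one_re] at this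
    linarith
  have := re_conj_apply_rpow_le hX hp (K * W) i hcon
  have e : (K * W)ᴴ * X * (K * W) = Wᴴ * (Kᴴ * X * K) * W := by
    simp only [conjTranspose_mul, Matrix.mul_assoc]
  rw [e, hev, Complex.ofReal_re] at this
  rwa [Complex.ofReal_re, diag_apply]

/-- Hölder's inequality for the trace of the product of two positive semidefinite matrices. -/
theorem re_trace_mul_le_rpow_mul_rpow {A B : Matrix n n ℂ} (hA : A.PosSemidef)
    (hB : B.PosSemidef) {p q : ℝ} (hpq : p.HolderConjugate q) :
    (A * B).trace.re ≤ (cfc (fun x : ℝ => x ^ p) A).trace.re ^ (1 / p) *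
      (cfc (fun x : ℝ => x ^ q) B).trace.re ^ (1 / q) := by
  have hA' := cfc_eq_conj_diagonal hA.1 id
  rw [cfc_id ℝ A hA.1.isSelfAdjoint] at hA'
  have hU' : _ * _ = (1 : Matrix n n ℂ) := eigenvectorUnitary_mul_conjTranspose hA.1
  have hU : _ * _ = (1 : Matrix n n ℂ) := conjTranspose_eigenvectorUnitary_mul hA.1
  rw [trace_cfc_eq_sum hA.1]
  set U := (hA.1.eigenvectorUnitary : Matrix n n ℂ)
  set l := hA.1.eigenvalues
  have hl : ∀ i, 0 ≤ l i := hA.eigenvalues_nonneg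
  have hb : ∀ i, 0 ≤ ((Uᴴ * B * U) i i).re := fun i =>
    (Complex.le_def.1 (hB.conjTranspose_mul_mul_same U).diag_nonneg).1
  -- In an eigenbasis of `A` only the diagonal of `B` contributes, so scalar Hölder applies; Jensen
  -- then compares powers of that diagonal with the diagonal of the power.
  have h1 : (A * B).trace.re = ∑ i, l i * ((Uᴴ * B * U) i i).re := by
    conv_lhs => rw [hA']
    rw [Matrix.mul_assoc, Matrix.trace_mul_comm, ← Matrix.mul_assoc, Matrix.trace_mul_comm,
      Matrix.trace, Complex.re_sum]
    refine Finset.sum_congr rfl fun i _ => ?_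
    rw [diag_apply, diagonal_mul, Complex.re_ofReal_mul]
    rfl
  have h2 : (cfc (fun x : ℝ => x ^ q) B).trace.re =
      ∑ i, ((Uᴴ * cfc (fun x : ℝ => x ^ q) B * U) i i).re := by
    have : (Uᴴ * cfc (fun x : ℝ => x ^ q) B * U).trace = (cfc (fun x : ℝ => x ^ q) B).trace := by
      rw [Matrix.mul_assoc, Matrix.trace_mul_comm, Matrix.mul_assoc, hU', mul_one]
    rw [← this, Matrix.trace, Complex.re_sum]
    rfl
  rw [h1, h2, Complex.re_sum]
  simp only [Complex.ofReal_re]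
  refine (Real.inner_le_Lp_mul_Lq_of_nonneg Finset.univ hpq (fun i _ => hl i)
    (fun i _ => hb i)).trans ?_
  refine mul_le_mul_of_nonneg_left (Real.rpow_le_rpow
    (Finset.sum_nonneg fun i _ => Real.rpow_nonneg (hb i) _) (Finset.sum_le_sum fun i _ => ?_)
    (one_div_nonneg.2 hpq.symm.nonneg)) (Real.rpow_nonneg
      (Finset.sum_nonneg fun i _ => Real.rpow_nonneg (hl i) _) _)
  exact re_conj_apply_rpow_le hB hpq.symm.lt.le U i (by rw [hU, one_apply_eq, Complex.one_re])

/-- Both products have the same characteristic polynomial, hence the same eigenvalues with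
multiplicity. -/
theorem trace_cfc_conjTranspose_mul_self (C : Matrix n n ℂ) (f : ℝ → ℝ) :
    (cfc f (Cᴴ * C)).trace = (cfc f (C * Cᴴ)).trace := by
  have h1 := isHermitian_conjTranspose_mul_self C
  have h2 := isHermitian_mul_conjTranspose_self C
  rw [trace_cfc_eq_sum h1, trace_cfc_eq_sum h2,
    (h1.eigenvalues_eq_eigenvalues_iff h2).2 (charpoly_mul_comm _ _)]

theorem posSemidef_cfc {A : Matrix n n ℂ} (hA : A.IsHermitian) {f : ℝ → ℝ}
    (hf : ∀ i, 0 ≤ f (hA.eigenvalues i)) : (cfc f A).PosSemidef := by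
  rw [cfc_eq_conj_diagonal hA f]
  refine PosSemidef.mul_mul_conjTranspose_same (PosSemidef.diagonal fun i => ?_) _
  exact Complex.zero_le_real.2 (hf i)

theorem eigenvalue_of_mem_spectrum {A : Matrix n n ℂ} (hA : A.IsHermitian) {x : ℝ}
    (hx : x ∈ spectrum ℝ A) : ∃ i, hA.eigenvalues i = x := by
  rwa [hA.spectrum_real_eq_range_eigenvalues] at hx

theorem cfc_rpow_mul_cfc_rpow {A : Matrix n n ℂ} (hA : A.PosDef) (s t : ℝ) :
    cfc (fun x : ℝ => x ^ s) A * cfc (fun x : ℝ => x ^ t) A = cfc (fun x : ℝ => x ^ (s + t)) A := by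
  rw [← cfc_mul _ _ A (continuousOn_spectrum _ A) (continuousOn_spectrum _ A)]
  refine cfc_congr fun x hx => ?_
  obtain ⟨i, rfl⟩ := eigenvalue_of_mem_spectrum hA.1 hx
  exact (Real.rpow_add (hA.eigenvalues_pos i) s t).symm

theorem cfc_sqrt_mul_self {A : Matrix n n ℂ} (hA : A.PosSemidef) :
    cfc Real.sqrt A * cfc Real.sqrt A = A := by
  rw [← cfc_mul _ _ A (continuousOn_spectrum _ A) (continuousOn_spectrum _ A)]
  conv_rhs => rw [← cfc_id ℝ A hA.1.isSelfAdjoint]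
  refine cfc_congr fun x hx => ?_
  obtain ⟨i, rfl⟩ := eigenvalue_of_mem_spectrum hA.1 hx
  exact Real.mul_self_sqrt (hA.eigenvalues_nonneg i)

theorem cfc_rpow_cfc_rpow {A : Matrix n n ℂ} (hA : A.PosSemidef) {s t : ℝ} (hst : s * t = 1) :
    cfc (fun x : ℝ => x ^ t) (cfc (fun x : ℝ => x ^ s) A) = A := by
  have := cfc_comp (fun x : ℝ => x ^ t) (fun x : ℝ => x ^ s) A hA.1.isSelfAdjoint
    ((A.finite_real_spectrum.image _).continuousOn _) (continuousOn_spectrum _ A)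
  rw [← this]
  conv_rhs => rw [← cfc_id ℝ A hA.1.isSelfAdjoint]
  refine cfc_congr fun x hx => ?_
  obtain ⟨i, rfl⟩ := eigenvalue_of_mem_spectrum hA.1 hx
  simp only [Function.comp, id]
  rw [← Real.rpow_mul (hA.eigenvalues_nonneg i), hst, Real.rpow_one]

/-- The sandwiched Rényi bound for the probability of the outcome `E` of a measurement. -/
theorem re_trace_mul_le_sandwiched {ρ σ E : Matrix n n ℂ} (hρ : ρ.PosSemidef) (hσ : σ.PosDef)
    (hE : E.PosSemidef) (hE' : (1 - E).PosSemidef) {α : ℝ} (hα : 1 < α) :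
    (ρ * E).trace.re ≤
      (cfc (fun x : ℝ => x ^ α) (cfc (fun x : ℝ => x ^ ((1 - α) / (2 * α))) σ * ρ *
        cfc (fun x : ℝ => x ^ ((1 - α) / (2 * α))) σ)).trace.re ^ (1 / α) *
      (σ * E).trace.re ^ ((α - 1) / α) := by
  have hα0 : 0 < α := by linarith
  have hα1 : 0 < α - 1 := by linarith
  set s : ℝ := (α - 1) / (2 * α) with hs
  set β : ℝ := α / (α - 1) with hβ
  have hns : (1 - α) / (2 * α) = -s := by rw [hs]; ring
  have hβ1 : (α - 1) / α = 1 / β := by rw [hβ, one_div_div]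
  have hpq : α.HolderConjugate β := Real.HolderConjugate.conjExponent hα
  rw [hns, hβ1]
  set P := cfc (fun x : ℝ => x ^ s) σ
  set N := cfc (fun x : ℝ => x ^ (-s)) σ
  set K := cfc Real.sqrt E
  have hPH : Pᴴ = P := cfc_isHermitian _ _
  have hNH : Nᴴ = N := cfc_isHermitian _ _
  have hKH : Kᴴ = K := cfc_isHermitian _ _
  have hKK : K * K = E := cfc_sqrt_mul_self hE
  have h0 : cfc (fun x : ℝ => x ^ (0 : ℝ)) σ = 1 := by
    simp only [Real.rpow_zero]
    exact cfc_const_one ℝ σ hσ.1.isSelfAdjoint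
  have hPN : P * N = 1 := by rw [cfc_rpow_mul_cfc_rpow hσ, add_neg_cancel, h0]
  have hNP : N * P = 1 := by rw [cfc_rpow_mul_cfc_rpow hσ, neg_add_cancel, h0]
  have hQ : (N * ρ * N).PosSemidef := by
    simpa only [hNH] using hρ.conjTranspose_mul_mul_same N
  have hY : (P * E * P).PosSemidef := by
    simpa only [hPH] using hE.conjTranspose_mul_mul_same P
  have htr : (ρ * E).trace = ((N * ρ * N) * (P * E * P)).trace := by
    have : (N * ρ * N) * (P * E * P) = N * (ρ * (N * P) * E * P) := by
      simp only [Matrix.mul_assoc]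
    rw [this, hNP, mul_one, Matrix.trace_mul_comm N, Matrix.mul_assoc _ P, hPN, mul_one]
  rw [htr]
  refine (re_trace_mul_le_rpow_mul_rpow hQ hY hpq).trans ?_
  have hcfc_nonneg : ∀ {B : Matrix n n ℂ}, B.PosSemidef → ∀ p : ℝ,
      0 ≤ (cfc (fun x : ℝ => x ^ p) B).trace.re := fun hB p =>
    (Complex.le_def.1 (posSemidef_cfc hB.1
      fun i => Real.rpow_nonneg (hB.eigenvalues_nonneg i) p).trace_nonneg).1
  refine mul_le_mul_of_nonneg_left (Real.rpow_le_rpow (hcfc_nonneg hY β) ?_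
    (one_div_nonneg.2 hpq.symm.nonneg)) (Real.rpow_nonneg (hcfc_nonneg hQ α) _)
  -- Swapping the factors of this product moves `E` to the outside, as the contraction in Jensen's
  -- inequality.
  have e1 : P * E * P = (K * P)ᴴ * (K * P) := by
    rw [conjTranspose_mul, hPH, hKH, ← hKK]
    simp only [Matrix.mul_assoc]
  have e2 : (K * P) * (K * P)ᴴ = Kᴴ * cfc (fun x : ℝ => x ^ (s + s)) σ * K := by
    rw [conjTranspose_mul, hPH, hKH, ← cfc_rpow_mul_cfc_rpow hσ]
    simp only [Matrix.mul_assoc, P]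
  have hX : (cfc (fun x : ℝ => x ^ (s + s)) σ).PosSemidef :=
    posSemidef_cfc hσ.1 fun i => Real.rpow_nonneg (hσ.eigenvalues_pos i).le _
  have hK : (1 - Kᴴ * K).PosSemidef := by rwa [hKH, hKK]
  rw [e1, trace_cfc_conjTranspose_mul_self, e2]
  refine (re_trace_conj_rpow_le hX hpq.symm.lt.le K hK).trans_eq ?_
  have hss : (s + s) * β = 1 := by
    rw [hs, hβ]; field_simp; ring
  rw [cfc_rpow_cfc_rpow hσ.posSemidef hss, hKH, Matrix.trace_mul_comm, ← Matrix.mul_assoc, hKK,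
    Matrix.trace_mul_comm]

end Matrix

end QuditConcentration

namespace QuditConcentration

/-! ### Rényi divergence and transfer of tail bounds. -/

section State

variable {V : Type*} [Fintype V] [DecidableEq V] {d : ℕ}

/-- The trace functional inside the logarithm of the sandwiched Rényi divergence. -/
noncomputable def renyiTrace (α : ℝ) (ρ σ : Op V d) : ℝ :=
  ((opPow (opPow σ ((1 - α) / (2 * α)) * ρ * opPow σ ((1 - α) / (2 * α))) α).trace).re

theorem expect_le_renyiTrace {ρ σ E : Op V d} (hρ : ρ.PosSemidef) (hσ : σ.PosDef)
    (hE : IsPOVMElement E) {α : ℝ} (hα : 1 < α) :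
    expect ρ E ≤ renyiTrace α ρ σ ^ (1 / α) * expect σ E ^ ((α - 1) / α) :=
  re_trace_mul_le_sandwiched hρ hσ hE.1 hE.2 hα

/-- The case `E = 1` of the main bound. Positivity is what later allows the trace to be recovered
from its real logarithm. -/
theorem one_le_renyiTrace {ρ σ : Op V d} (hρ : IsState ρ) (hσ : IsState σ) (hσ' : σ.PosDef)
    {α : ℝ} (hα : 1 < α) : 1 ≤ renyiTrace α ρ σ := by
  have h := expect_le_renyiTrace (E := 1) hρ.1 hσ'
    ⟨Matrix.PosSemidef.one, by rw [sub_self]; exact Matrix.PosSemidef.zero⟩ hα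
  simp only [expect, mul_one, hρ.2, hσ.2, Complex.one_re, Real.one_rpow] at h
  have hα0 : 0 < 1 / α := by positivity
  by_contra! hlt
  have h0 : 0 ≤ renyiTrace α ρ σ := by
    have hH : (opPow σ ((1 - α) / (2 * α))).IsHermitian := cfc_isHermitian _ _
    have hQ := hρ.1.conjTranspose_mul_mul_same (opPow σ ((1 - α) / (2 * α)))
    rw [hH.eq] at hQ
    exact (Complex.le_def.1 (posSemidef_cfc hQ.1
      fun i => Real.rpow_nonneg (hQ.eigenvalues_nonneg i) α).trace_nonneg).1
  exact absurd (Real.rpow_lt_one h0 hlt hα0) (not_lt.2 h)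

theorem renyiDiv_eq_of_posDef {σ : Op V d} (hσ : σ.PosDef) (α : ℝ) (ρ : Op V d) :
    renyiDiv α ρ σ = ((1 / (α - 1) * Real.log (renyiTrace α ρ σ) : ℝ) : EReal) := by
  have hrange : LinearMap.range σ.mulVecLin = ⊤ :=
    LinearMap.range_eq_top.2 (Matrix.mulVec_surjective_iff_isUnit.2 hσ.isUnit)
  rw [renyiDiv, if_pos (hrange ▸ le_top)]
  rfl

theorem expect_nonneg {σ E : Op V d} (hσ : σ.PosSemidef) (hE : E.PosSemidef) :
    0 ≤ expect σ E := by
  have hK : (cfc Real.sqrt E : Op V d).conjTranspose = cfc Real.sqrt E := cfc_isHermitian _ _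
  have h := (hσ.conjTranspose_mul_mul_same (cfc Real.sqrt E)).trace_nonneg
  rw [hK, Matrix.trace_mul_comm, ← Matrix.mul_assoc, cfc_sqrt_mul_self hE,
    Matrix.trace_mul_comm] at h
  exact (Complex.le_def.1 h).1

/-- A free upper bound `x` on the log-probability serves both the measurement bound and the Gaussian
tail. -/
theorem expect_le_exp {ρ σ E : Op V d} (hρ : IsState ρ) (hσ : IsState σ) (hσ' : σ.PosDef)
    (hE : IsPOVMElement E) {α : ℝ} (hα : 1 < α) {x : ℝ} (hx : expect σ E ≤ Real.exp x) :
    expect ρ E ≤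
      Real.exp ((α - 1) / α * (1 / (α - 1) * Real.log (renyiTrace α ρ σ) + x)) := by
  have hα1 : 0 < α - 1 := by linarith
  have hα0 : 0 < α := by linarith
  have hT : 0 < renyiTrace α ρ σ := one_pos.trans_le (one_le_renyiTrace hρ hσ hσ' hα)
  refine (expect_le_renyiTrace hρ.1 hσ' hE hα).trans ?_
  calc _ ≤ renyiTrace α ρ σ ^ (1 / α) * Real.exp x ^ ((α - 1) / α) :=
        mul_le_mul_of_nonneg_left
          (Real.rpow_le_rpow (expect_nonneg hσ.1 hE.1) hx (by positivity))
          (Real.rpow_nonneg hT.le _)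
    _ = _ := by
        rw [Real.rpow_def_of_pos hT, ← Real.exp_mul, ← Real.exp_add]
        congr 1
        field_simp

/-- Handles the exponent `-∞`, which comes from `log 0` or from an infinite Gaussian rate. -/
theorem expect_nonpos_of_expect_eq_zero {ρ σ E : Op V d} (hρ : ρ.PosSemidef) (hσ : σ.PosDef)
    (hE : IsPOVMElement E) {α : ℝ} (hα : 1 < α) (h0 : expect σ E = 0) : expect ρ E ≤ 0 := by
  have hα1 : 0 < α - 1 := by linarith
  have hα0 : 0 < α := by linarith
  have h := expect_le_renyiTrace hρ hσ hE hα
  rwa [h0, Real.zero_rpow (by positivity), mul_zero] at h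

theorem coe_exp_coe (x : ℝ) : ((EReal.exp (x : EReal) : ENNReal) : EReal) = (Real.exp x : ℝ) := by
  rw [EReal.exp_coe, EReal.coe_ennreal_ofReal, max_eq_left (Real.exp_pos x).le]

theorem expect_le_exp_renyiDiv {ρ σ E : Op V d} (hρ : IsState ρ) (hσ : IsState σ)
    (hσ' : σ.PosDef) (hE : IsPOVMElement E) {α : ℝ} (hα : 1 < α) :
    ((expect ρ E : ℝ) : EReal) ≤
      (EReal.exp ((((α - 1) / α : ℝ) : EReal) *
        (renyiDiv α ρ σ + ENNReal.log (ENNReal.ofReal (expect σ E)))) : EReal) := by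
  rw [renyiDiv_eq_of_posDef hσ']
  rcases (expect_nonneg hσ.1 hE.1).eq_or_lt with h0 | h0
  · refine le_trans ?_ (EReal.coe_ennreal_nonneg _)
    exact_mod_cast expect_nonpos_of_expect_eq_zero hρ.1 hσ' hE hα h0.symm
  · rw [ENNReal.log_ofReal_of_pos h0, ← EReal.coe_add, ← EReal.coe_mul, coe_exp_coe,
      EReal.coe_le_coe_iff]
    exact expect_le_exp hρ hσ hσ' hE hα (Real.exp_log h0).ge

theorem isPOVMElement_projGE {A : Op V d} (hA : A.IsHermitian) (r : ℝ) :
    IsPOVMElement (projGE A r) := by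
  classical
  refine ⟨posSemidef_cfc hA fun i => by split_ifs <;> norm_num, ?_⟩
  have h : (1 : Op V d) - projGE A r = cfc (fun x : ℝ => 1 - if r ≤ x then (1 : ℝ) else 0) A := by
    rw [cfc_sub _ _ A (continuousOn_spectrum _ A) (continuousOn_spectrum _ A),
      cfc_const_one ℝ A hA.isSelfAdjoint]
    rfl
  rw [h]
  exact posSemidef_cfc hA fun i => by split_ifs <;> norm_num

theorem transferredTail_of_gaussianTail {σ O : Op V d} {c K a : ℝ} (hσ : IsState σ)
    (hσ' : σ.PosDef) (hK : 0 < K) (h : GaussianTail σ O c K a) {ρ : Op V d} (hρ : IsState ρ)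
    {α : ℝ} (hα : 1 < α) : TransferredTail ρ σ O c K a α := by
  have hE := isPOVMElement_projGE
    (cfc_isHermitian (fun x : ℝ => |x|) (O - ((expect σ O : ℝ) : ℂ) • (1 : Op V d)))
    (a * Fintype.card V)
  unfold GaussianTail deviationProb prob opAbs at h
  unfold TransferredTail deviationProb prob opAbs
  rw [renyiDiv_eq_of_posDef hσ']
  generalize gaussRate σ O c a = r at h ⊢
  induction r with
  | top =>
    -- An infinite rate makes the hypothesis say that the event has `σ`-probability zero.
    rw [EReal.coe_ennreal_top, EReal.neg_top, EReal.exp_bot, EReal.coe_ennreal_zero, mul_zero]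
      at h
    have h0 := le_antisymm (EReal.coe_le_coe_iff.1 h) (expect_nonneg hσ.1 hE.1)
    refine le_trans ?_ (EReal.coe_ennreal_nonneg _)
    exact_mod_cast expect_nonpos_of_expect_eq_zero hρ.1 hσ' hE hα h0
  | coe r =>
    have hr : (((r : NNReal) : ENNReal) : EReal) = ((r : ℝ) : EReal) := rfl
    rw [hr, ← EReal.coe_neg, coe_exp_coe, ← EReal.coe_mul, EReal.coe_le_coe_iff] at h
    rw [hr, ← EReal.coe_sub, ← EReal.coe_add, ← EReal.coe_mul, coe_exp_coe,
      EReal.coe_le_coe_iff, sub_add_eq_add_sub, add_sub_assoc]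
    refine expect_le_exp hρ hσ hσ' hE hα (h.trans_eq ?_)
    rw [sub_eq_add_neg, Real.exp_add, Real.exp_log hK]

end State

end QuditConcentration

theorem mainTheorem7 {V : Type*} [Fintype V] [DecidableEq V] [Nonempty V] (d : ℕ)
    (σ : QuditConcentration.Op V d) (hσ : QuditConcentration.IsState σ) (hσpos : σ.PosDef) :
    (∀ ρ : QuditConcentration.Op V d, QuditConcentration.IsState ρ →
      ∀ E : QuditConcentration.Op V d, QuditConcentration.IsPOVMElement E →
      ∀ α : ℝ, 1 < α →
        ((QuditConcentration.expect ρ E : ℝ) : EReal) ≤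
          (EReal.exp ((((α - 1) / α : ℝ) : EReal) *
            (QuditConcentration.renyiDiv α ρ σ +
              ENNReal.log (ENNReal.ofReal (QuditConcentration.expect σ E)))) : EReal)) ∧
    (∀ c K : ℝ, 0 < c → 0 < K →
      ∀ O : QuditConcentration.Op V d, O.IsHermitian → ∀ a : ℝ, 0 < a →
      QuditConcentration.GaussianTail σ O c K a →
      ∀ ρ : QuditConcentration.Op V d, QuditConcentration.IsState ρ → ∀ α : ℝ, 1 < α →
        QuditConcentration.TransferredTail ρ σ O c K a α) ∧
    (∀ c K : ℝ, 0 < c → 0 < K → QuditConcentration.GaussianConcentration σ c K →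
      ∀ ρ : QuditConcentration.Op V d, QuditConcentration.IsState ρ →
      ∀ O : QuditConcentration.Op V d, O.IsHermitian → ∀ a : ℝ, 0 < a → ∀ α : ℝ, 1 < α →
        QuditConcentration.TransferredTail ρ σ O c K a α) := by
  exact ⟨fun _ hρ _ hE _ hα =>
    QuditConcentration.expect_le_exp_renyiDiv hρ hσ hσpos hE hα,
    fun _ _ _ hK _ _ _ _ h _ hρ _ hα =>
      QuditConcentration.transferredTail_of_gaussianTail hσ hσpos hK h hρ hα,
    fun _ _ _ hK h _ hρ O hO a ha _ hα =>
      QuditConcentration.transferredTail_of_gaussianTail hσ hσpos hK (h O hO a ha) hρ hα⟩
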